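/- Let $n\ge 0$, $x\in\mathbb{R}^n$, let $O$ be the algebra of germs at $x$ of complex-valued real-analytic functions on $\mathbb{R}^n$, with residue map $O\to\mathbb{C}$, $f\mapsto f(x)$, and let $D$ be the algebra of linear differential operators with coefficients in $O$, filtered by the $O$-submodules $D_k$ of operators of order at most $k$ ($D_k=0$ for $k<0$). Its associated graded algebra is $\mathrm{gr}\,D\cong O[\xi_1,\dots,\xi_n]$, with $\xi_i$ the class of $\partial/\partial x_i$. A filtered left $D$-module is a left $D$-module $M$ with an increasing exhaustive sequence of $O$-submodules $M_k$, $k\in\mathbb{Z}$, such that $D_iM_k\subset M_{i+k}$; then $\mathrm{gr}\,M=\bigoplus_k M_k/M_{k-1}$ is a $\mathrm{gr}\,D$-module. The characteristic variety $V(M)\subset\mathbb{C}^n$ is the set of points whose maximal ideal belongs to the support of the $\mathbb{C}[\xi_1,\dots,\xi_n]$-module $\mathrm{gr}\,M\otimes_O\mathbb{C}$, and $M$ is called elliptic if $V(M)$ contains no real point $\xi\neq 0$. For a shift vector $\rho\in\mathbb{Z}^r$ let $D^\rho$ be the free left module $D^r$ filtered by $D^\rho_k=\{a : \mathrm{ord}\,a_j+\rho_j\le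 k \text{ for all } j\}$. A morphism $\alpha:E\to F$ of filtered left $D$-modules is strict if $\alpha(E_k)=\alpha(E)\cap F_k$ for all $k\in\mathbb{Z}$. Let $M$ be an elliptic filtered left $D$-module such that $\mathrm{gr}\,M$ is a free $O$-module, and let $$\cdots\to D^{\rho_2}\xrightarrow{P_1}D^{\rho_1}\xrightarrow{P_0}D^{\rho_0}\xrightarrow{\pi}M\to 0$$ be an exact sequence of left $D$-modules in which all morphisms are strict, $\rho_k\in\mathbb{Z}^{r_k}$, and $P_k$ is right multiplication of rows by an $r_{k+1}\times r_k$ matrix $(p^{(k)}_{ij})$ with entries in $D$. For $\xi\in\mathbb{C}^n$ let $\mathrm{P}_k(x,\xi)$ be the complex matrix whose $(i,j)$ entry is obtained from the sum of the terms of $p^{(k)}_{ij}$ of order $\rho_{k+1,i}-\rho_{k,j}$ by evaluating the coefficients at $x$ and replacing $\partial/\partial x_l$ by $\xi_l$. Then the resolution is an elliptic complex: for every real $\xi\neq 0$ its principal symbol $$\cdots\to\mathbb{C}^{r_2}\xrightarrow{\mathrm{P}_1(x,\xi)}\mathbb{C}^{r_1}\xrightarrow{\mathrm{P}_0(x,\xi)}\mathbb{C}^{r_0}\to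 0$$ (row vectors, right multiplication) is exact at every term. -/

import Mathlib

open Filter Topology
open scoped TensorProduct DirectSum IsMulCommutative

noncomputable section

/-! ## Polynomials in commuting elements -/

/-- Evaluation of polynomials with coefficients in `R` at a family `T` of pairwise commuting
elements of a (possibly non-commutative) `R`-algebra. -/
def commEval {ι R A : Type*} [CommSemiring R] [Semiring A] [Algebra R A] (T : ι → A)
    (hT : ∀ i j, T i * T j = T j * T i) : MvPolynomial ι R →ₐ[R] A :=
  haveI : IsMulCommutative (Algebra.adjoin R (Set.range T)) :=
    Algebra.isMulCommutative_adjoin R (by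
      rintro _ ⟨i, rfl⟩ _ ⟨j, rfl⟩
      exact hT i j)
  (Algebra.adjoin R (Set.range T)).val.comp
    (MvPolynomial.aeval (R := R) (S₁ := Algebra.adjoin R (Set.range T))
      fun i => ⟨T i, Algebra.subset_adjoin ⟨i, rfl⟩⟩)

theorem commEval_X {ι R A : Type*} [CommSemiring R] [Semiring A] [Algebra R A] (T : ι → A)
    (hT : ∀ i j, T i * T j = T j * T i) (i : ι) :
    commEval (R := R) T hT (MvPolynomial.X i) = T i := by
  simp [commEval]

/-! ## Germs of analytic functions -/

/-- The ring of germs at `x` of complex valued real analytic functions on `ℝⁿ`,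
as a subring of the ring of germs of all functions. -/
def analyticSubring {n : ℕ} (x : Fin n → ℝ) : Subring (Germ (𝓝 x) ℂ) where
  carrier := {g | ∃ f : (Fin n → ℝ) → ℂ, AnalyticAt ℝ f x ∧ (f : Germ (𝓝 x) ℂ) = g}
  mul_mem' := by
    rintro _ _ ⟨f, hf, rfl⟩ ⟨g, hg, rfl⟩
    exact ⟨f * g, hf.mul hg, rfl⟩
  one_mem' := ⟨fun _ => 1, analyticAt_const, rfl⟩
  add_mem' := by
    rintro _ _ ⟨f, hf, rfl⟩ ⟨g, hg, rfl⟩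
    exact ⟨f + g, hf.add hg, rfl⟩
  zero_mem' := ⟨fun _ => 0, analyticAt_const, rfl⟩
  neg_mem' := by
    rintro _ ⟨f, hf, rfl⟩
    exact ⟨-f, hf.neg, rfl⟩

/-- The algebra `O` of germs at `x` of analytic functions. -/
def AnalyticGerm {n : ℕ} (x : Fin n → ℝ) : Type := analyticSubring x

namespace AnalyticGerm

variable {n : ℕ} {x : Fin n → ℝ}

instance : CommRing (AnalyticGerm x) := inferInstanceAs (CommRing (analyticSubring x))

/-- The germ of a function which is analytic at `x`. -/
def of (f : (Fin n → ℝ) → ℂ) (hf : AnalyticAt ℝ f x) : AnalyticGerm x :=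
  ⟨(f : Germ (𝓝 x) ℂ), f, hf, rfl⟩

theorem exists_rep (g : AnalyticGerm x) : ∃ f hf, g = of f hf := by
  obtain ⟨_, f, hf, rfl⟩ := g
  exact ⟨f, hf, rfl⟩

theorem of_eq {f g : (Fin n → ℝ) → ℂ} {hf : AnalyticAt ℝ f x} {hg : AnalyticAt ℝ g x}
    (h : f =ᶠ[𝓝 x] g) : of f hf = of g hg :=
  Subtype.ext (Germ.coe_eq.2 h)

/-- Constant functions make `O` a complex algebra. -/
instance : Algebra ℂ (AnalyticGerm x) :=
  RingHom.toAlgebra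
    { toFun := fun c => of (fun _ => c) analyticAt_const
      map_one' := rfl
      map_mul' := fun _ _ => rfl
      map_zero' := rfl
      map_add' := fun _ _ => rfl }

theorem of_add (f g : (Fin n → ℝ) → ℂ) (hf : AnalyticAt ℝ f x) (hg : AnalyticAt ℝ g x) :
    of f hf + of g hg = of (f + g) (hf.add hg) := rfl

theorem of_mul (f g : (Fin n → ℝ) → ℂ) (hf : AnalyticAt ℝ f x) (hg : AnalyticAt ℝ g x) :
    of f hf * of g hg = of (f * g) (hf.mul hg) := rfl

theorem algebraMap_apply (c : ℂ) :
    algebraMap ℂ (AnalyticGerm x) c = of (fun _ => c) analyticAt_const := rfl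

/-- The value at `x`: the residue homomorphism `O → ℂ`. -/
def value : AnalyticGerm x →+* ℂ :=
  Germ.valueRingHom.comp (analyticSubring x).subtype

/-- `ℂ` as an `O`-algebra, through the value at `x`. -/
instance : Algebra (AnalyticGerm x) ℂ := value.toAlgebra

theorem analyticAt_partial {f : (Fin n → ℝ) → ℂ} (hf : AnalyticAt ℝ f x) (v : Fin n → ℝ) :
    AnalyticAt ℝ (fun y => fderiv ℝ f y v) x :=
  ((ContinuousLinearMap.apply ℝ ℂ v).analyticAt _).comp hf.fderiv

/-- The partial derivative of germs of functions. -/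
def partialGerm (i : Fin n) : Germ (𝓝 x) ℂ → Germ (𝓝 x) ℂ :=
  Germ.map' (fun f y => fderiv ℝ f y (Pi.single i 1)) (by
    intro f g h
    exact (h.fderiv (𝕜 := ℝ)).mono fun y hy =>
      congrArg (fun T : (Fin n → ℝ) →L[ℝ] ℂ => T (Pi.single i 1)) hy)

/-- The partial derivative on `O`, as a map. -/
def partialFun (i : Fin n) (g : AnalyticGerm x) : AnalyticGerm x :=
  ⟨partialGerm i g.1, by
    obtain ⟨f, hf, h⟩ := g.2
    refine ⟨fun y => fderiv ℝ f y (Pi.single i 1), analyticAt_partial hf _, ?_⟩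
    rw [← h]
    rfl⟩

theorem partialFun_of (i : Fin n) (f : (Fin n → ℝ) → ℂ) (hf : AnalyticAt ℝ f x) :
    partialFun i (of f hf) =
      of (fun y => fderiv ℝ f y (Pi.single i 1)) (analyticAt_partial hf _) := rfl

theorem partialFun_add (i : Fin n) (f g : AnalyticGerm x) :
    partialFun i (f + g) = partialFun i f + partialFun i g := by
  obtain ⟨f, hf, rfl⟩ := exists_rep f
  obtain ⟨g, hg, rfl⟩ := exists_rep g
  rw [of_add, partialFun_of, partialFun_of, partialFun_of, of_add]
  apply of_eq
  filter_upwards [hf.eventually_analyticAt, hg.eventually_analyticAt] with y h1 h2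
  simp [fderiv_add h1.differentiableAt h2.differentiableAt]

theorem partialFun_mul (i : Fin n) (f g : AnalyticGerm x) :
    partialFun i (f * g) = f * partialFun i g + g * partialFun i f := by
  obtain ⟨f, hf, rfl⟩ := exists_rep f
  obtain ⟨g, hg, rfl⟩ := exists_rep g
  rw [of_mul, partialFun_of, partialFun_of, partialFun_of, of_mul, of_mul, of_add]
  apply of_eq
  filter_upwards [hf.eventually_analyticAt, hg.eventually_analyticAt] with y h1 h2
  simp [fderiv_mul h1.differentiableAt h2.differentiableAt]

theorem partialFun_algebraMap (i : Fin n) (c : ℂ) :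
    partialFun i (algebraMap ℂ (AnalyticGerm x) c) = 0 := by
  rw [algebraMap_apply, partialFun_of]
  exact of_eq (hg := analyticAt_const) (Eventually.of_forall fun y => by simp)

/-- The partial derivative `∂/∂xᵢ` as a derivation of `O`. -/
def partialD (i : Fin n) : Derivation ℂ (AnalyticGerm x) (AnalyticGerm x) where
  toFun := partialFun i
  map_add' := partialFun_add i
  map_smul' c f := by
    rw [Algebra.smul_def, partialFun_mul, partialFun_algebraMap, RingHom.id_apply,
      Algebra.smul_def, mul_zero, add_zero]
  map_one_eq_zero' := by
    have := partialFun_algebraMap (x := x) i 1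
    rwa [map_one] at this
  leibniz' f g := partialFun_mul i f g

theorem partialD_comm (i j : Fin n) (f : AnalyticGerm x) :
    partialD i (partialD j f) = partialD j (partialD i f) := by
  obtain ⟨f, hf, rfl⟩ := exists_rep f
  change partialFun i (partialFun j _) = partialFun j (partialFun i _)
  simp only [partialFun_of]
  apply of_eq
  filter_upwards [hf.eventually_analyticAt] with y h
  have hd : DifferentiableAt ℝ (fderiv ℝ f) y := h.fderiv.differentiableAt
  have hs : IsSymmSndFDerivAt ℝ f y :=
    (h.contDiffAt (n := 2)).isSymmSndFDerivAt (by simp)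
  have key : ∀ v w : Fin n → ℝ,
      fderiv ℝ (fun z => fderiv ℝ f z v) y w = fderiv ℝ (fderiv ℝ f) y w v := by
    intro v w
    have := fderiv_clm_apply hd (differentiableAt_const (x := y) v)
    simp [this]
  rw [key, key]
  exact hs _ _

theorem analyticAt_coord (i : Fin n) : AnalyticAt ℝ (fun y : Fin n → ℝ => (y i : ℂ)) x :=
  (Complex.ofRealCLM.comp (ContinuousLinearMap.proj (R := ℝ) (φ := fun _ => ℝ) i)).analyticAt x

/-- The germ of the coordinate function `xᵢ`. -/
def coord (i : Fin n) : AnalyticGerm x := of (fun y => (y i : ℂ)) (analyticAt_coord i)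

theorem partialD_coord (i j : Fin n) :
    partialD i (coord (x := x) j) = if i = j then 1 else 0 := by
  change partialFun i _ = _
  unfold coord
  rw [partialFun_of]
  have : ∀ y : Fin n → ℝ, fderiv ℝ (fun y : Fin n → ℝ => (y j : ℂ)) y (Pi.single i 1)
      = if i = j then 1 else 0 := by
    intro y
    have h := (Complex.ofRealCLM.comp
      (ContinuousLinearMap.proj (R := ℝ) (φ := fun _ : Fin n => ℝ) j)).hasFDerivAt (x := y)
    have h2 : fderiv ℝ (fun y : Fin n → ℝ => (y j : ℂ)) y = _ := h.fderiv
    rw [h2]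
    by_cases h : i = j
    · simp [h]
    · simp [h, Ne.symm h]
  simp only [this]
  split_ifs <;> rfl

end AnalyticGerm

open AnalyticGerm

/-! ## The algebra of differential operators -/

/-- The algebra of differential operators with coefficients in `O`: the algebra of operators on `O`
generated by the multiplications by elements of `O` and by the partial derivatives. -/
def diffOpSubalgebra {n : ℕ} (x : Fin n → ℝ) : Subalgebra ℂ (Module.End ℂ (AnalyticGerm x)) :=
  Algebra.adjoin ℂ
    (Set.range (LinearMap.mulLeft ℂ : AnalyticGerm x → Module.End ℂ (AnalyticGerm x)) ∪
      Set.range fun i : Fin n => (partialD (x := x) i).toLinearMap)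

/-- The algebra `D` of differential operators in `O`. -/
def DiffOp {n : ℕ} (x : Fin n → ℝ) : Type := diffOpSubalgebra x

namespace DiffOp

variable {n : ℕ} {x : Fin n → ℝ}

instance : Ring (DiffOp x) := inferInstanceAs (Ring (diffOpSubalgebra x))

instance : Algebra ℂ (DiffOp x) := inferInstanceAs (Algebra ℂ (diffOpSubalgebra x))

/-- A differential operator, as a linear operator on `O`. -/
def toEnd (P : DiffOp x) : Module.End ℂ (AnalyticGerm x) := P.1

theorem ext {P Q : DiffOp x} (h : ∀ f, P.toEnd f = Q.toEnd f) : P = Q :=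
  Subtype.ext (LinearMap.ext h)

/-- The operator of multiplication by `f`. -/
def ofFun (f : AnalyticGerm x) : DiffOp x :=
  ⟨LinearMap.mulLeft ℂ f, Algebra.subset_adjoin (Or.inl ⟨f, rfl⟩)⟩

/-- The operator `∂/∂xᵢ`. -/
def del (i : Fin n) : DiffOp x :=
  ⟨(partialD i).toLinearMap, Algebra.subset_adjoin (Or.inr ⟨i, rfl⟩)⟩

@[simp] theorem toEnd_ofFun (f g : AnalyticGerm x) : (ofFun f).toEnd g = f * g := rfl
@[simp] theorem toEnd_del (i : Fin n) (g : AnalyticGerm x) :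
    (del (x := x) i).toEnd g = partialD i g := rfl
@[simp] theorem toEnd_mul (P Q : DiffOp x) (g : AnalyticGerm x) :
    (P * Q).toEnd g = P.toEnd (Q.toEnd g) := rfl
@[simp] theorem toEnd_add (P Q : DiffOp x) (g : AnalyticGerm x) :
    (P + Q).toEnd g = P.toEnd g + Q.toEnd g := rfl
@[simp] theorem toEnd_one (g : AnalyticGerm x) : (1 : DiffOp x).toEnd g = g := rfl
@[simp] theorem toEnd_zero (g : AnalyticGerm x) : (0 : DiffOp x).toEnd g = 0 := rfl

/-- `D` is a left `O`-module: `(f • P) g = f * P g`. -/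
instance : Module (AnalyticGerm x) (DiffOp x) where
  smul f P := ofFun f * P
  one_smul P := ext fun g => by
    change (ofFun 1 * P).toEnd g = _
    simp
  mul_smul f f' P := ext fun g => by
    change (ofFun (f * f') * P).toEnd g = (ofFun f * (ofFun f' * P)).toEnd g
    simp [mul_assoc]
  smul_zero f := mul_zero _
  smul_add f P Q := mul_add _ _ _
  add_smul f f' P := ext fun g => by
    change (ofFun (f + f') * P).toEnd g = (ofFun f * P + ofFun f' * P).toEnd g
    simp [add_mul]
  zero_smul P := ext fun g => by
    change (ofFun 0 * P).toEnd g = _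
    simp

theorem smul_def (f : AnalyticGerm x) (P : DiffOp x) : f • P = ofFun f * P := rfl

@[simp] theorem toEnd_smul (f : AnalyticGerm x) (P : DiffOp x) (g : AnalyticGerm x) :
    (f • P).toEnd g = f * P.toEnd g := rfl

instance : IsScalarTower (AnalyticGerm x) (DiffOp x) (DiffOp x) where
  smul_assoc f P Q := mul_assoc (ofFun f) P Q

theorem del_comm (i j : Fin n) : del (x := x) i * del j = del j * del i :=
  ext fun f => partialD_comm i j f

theorem del_mul_smul (i : Fin n) (f : AnalyticGerm x) (P : DiffOp x) :
    del i * (f • P) = f • (del i * P) + (partialD i f) • P :=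
  ext fun g => by simp [mul_comm]

/-- `∂^α`, and more generally `q(∂)` for a polynomial `q` with constant coefficients. -/
def polyDel : MvPolynomial (Fin n) ℂ →ₐ[ℂ] DiffOp x := commEval del del_comm

theorem polyDel_X (i : Fin n) : polyDel (x := x) (MvPolynomial.X i) = del i := commEval_X _ _ _

/-- The operator `∑ c_α ∂^α` with full symbol `∑ c_α ξ^α ∈ O[ξ]`. -/
def ofSymbol : MvPolynomial (Fin n) (AnalyticGerm x) →ₗ[AnalyticGerm x] DiffOp x :=
  (MvPolynomial.basisMonomials (Fin n) (AnalyticGerm x)).constr ℕ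
    fun α => polyDel (MvPolynomial.monomial α 1)

theorem ofSymbol_monomial (α : Fin n →₀ ℕ) (c : AnalyticGerm x) :
    ofSymbol (MvPolynomial.monomial α c) = c • polyDel (MvPolynomial.monomial α 1) := by
  have h : MvPolynomial.monomial α c =
      c • (MvPolynomial.basisMonomials (Fin n) (AnalyticGerm x)) α := by
    simp [MvPolynomial.smul_monomial]
  rw [h, map_smul, ofSymbol, Module.Basis.constr_basis]

theorem del_mul_polyDel (i : Fin n) (α : Fin n →₀ ℕ) :
    del i * polyDel (x := x) (MvPolynomial.monomial α 1) =
      polyDel (MvPolynomial.monomial (α + Finsupp.single i 1) 1) := by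
  rw [← polyDel_X, ← map_mul, MvPolynomial.X, MvPolynomial.monomial_mul, add_comm, one_mul]

/-- Commutation with a coordinate function differentiates the symbol. -/
theorem polyDel_coord_mul (i : Fin n) (q : MvPolynomial (Fin n) ℂ) (f : AnalyticGerm x) :
    (polyDel q).toEnd (coord i * f) =
      coord i * (polyDel q).toEnd f + (polyDel (MvPolynomial.pderiv i q)).toEnd f := by
  induction q using MvPolynomial.induction_on generalizing f with
  | C a =>
    have h : polyDel (x := x) (MvPolynomial.C a) = algebraMap ℂ (DiffOp x) a :=
      polyDel.commutes a
    have h2 : ∀ g : AnalyticGerm x, (algebraMap ℂ (DiffOp x) a).toEnd g = a • g := fun g => rfl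
    simp [h, h2]
  | add p q hp hq =>
    simp only [map_add, toEnd_add, hp, hq]
    ring
  | mul_X p j hp =>
    have e : ∀ (q : MvPolynomial (Fin n) ℂ) (g : AnalyticGerm x),
        (polyDel (q * MvPolynomial.X j)).toEnd g = (polyDel q).toEnd (partialD j g) := by
      intro q g
      rw [map_mul, polyDel_X]
      rfl
    have e2 : (partialD j) (coord i * f) =
        coord i * partialD j f + (if j = i then 1 else 0) * f := by
      rw [Derivation.leibniz, partialD_coord, smul_eq_mul, smul_eq_mul, mul_comm f]
    rw [e, e, e2, LinearMap.map_add, hp, Derivation.leibniz, MvPolynomial.pderiv_X, map_add,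
      smul_eq_mul, smul_eq_mul, mul_comm (MvPolynomial.X j), toEnd_add, e]
    by_cases hij : j = i
    · subst hij
      simp
      ring
    · simp [hij]

theorem ofSymbol_coord_mul (i : Fin n) (p : MvPolynomial (Fin n) (AnalyticGerm x))
    (f : AnalyticGerm x) :
    (ofSymbol p).toEnd (coord i * f) =
      coord i * (ofSymbol p).toEnd f + (ofSymbol (MvPolynomial.pderiv i p)).toEnd f := by
  induction p using MvPolynomial.induction_on' with
  | monomial α c =>
    rw [MvPolynomial.pderiv_monomial, ofSymbol_monomial, ofSymbol_monomial, toEnd_smul,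
      polyDel_coord_mul, toEnd_smul, toEnd_smul, MvPolynomial.pderiv_monomial, one_mul]
    have h : MvPolynomial.monomial (α - Finsupp.single i 1) ((α i : ℕ) : ℂ) =
        (α i) • MvPolynomial.monomial (α - Finsupp.single i 1) (1 : ℂ) := by
      rw [← map_nsmul]
      simp
    have h2 : ∀ (m : ℕ) (P : DiffOp x), (m • P).toEnd f = m • P.toEnd f := fun m P => rfl
    rw [h, map_nsmul, h2, nsmul_eq_mul]
    ring
  | add p q hp hq =>
    simp only [map_add, toEnd_add, hp, hq]
    ring

theorem polyDel_one_apply (q : MvPolynomial (Fin n) ℂ) :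
    (polyDel q).toEnd (1 : AnalyticGerm x) =
      algebraMap ℂ (AnalyticGerm x) (MvPolynomial.constantCoeff q) := by
  induction q using MvPolynomial.induction_on with
  | C a =>
    have h : polyDel (x := x) (MvPolynomial.C a) = algebraMap ℂ (DiffOp x) a :=
      polyDel.commutes a
    have h2 : ∀ g : AnalyticGerm x, (algebraMap ℂ (DiffOp x) a).toEnd g = a • g := fun g => rfl
    simp [h, h2, Algebra.smul_def]
  | add p q hp hq => simp only [map_add, toEnd_add, hp, hq]
  | mul_X p j hp =>
    rw [map_mul, polyDel_X, toEnd_mul, toEnd_del, Derivation.map_one_eq_zero]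
    simp

theorem ofSymbol_one_apply (p : MvPolynomial (Fin n) (AnalyticGerm x)) :
    (ofSymbol p).toEnd 1 = MvPolynomial.coeff 0 p := by
  induction p using MvPolynomial.induction_on' with
  | monomial α c =>
    rw [ofSymbol_monomial, toEnd_smul, polyDel_one_apply, MvPolynomial.constantCoeff_monomial,
      MvPolynomial.coeff_monomial]
    split_ifs <;> simp
  | add p q hp hq => simp only [map_add, toEnd_add, hp, hq, MvPolynomial.coeff_add]

theorem ofSymbol_injective : Function.Injective (ofSymbol (x := x)) := by
  rw [injective_iff_map_eq_zero]
  have key : ∀ (N : ℕ) (α : Fin n →₀ ℕ) (p : MvPolynomial (Fin n) (AnalyticGerm x)),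
      α.degree = N → ofSymbol p = 0 → MvPolynomial.coeff α p = 0 := by
    intro N
    induction N with
    | zero =>
      intro α p hα hp
      rw [Finsupp.degree_eq_zero_iff] at hα
      rw [hα, ← ofSymbol_one_apply, hp, toEnd_zero]
    | succ N ih =>
      intro α p hα hp
      obtain ⟨i, hi⟩ : ∃ i, α i ≠ 0 := by
        by_contra! h
        have : α = 0 := Finsupp.ext h
        simp [this] at hα
      obtain ⟨β, rfl⟩ : ∃ β, α = β + Finsupp.single i 1 :=
        ⟨α - Finsupp.single i 1, (tsub_add_cancel_of_le (by
          rw [Finsupp.single_le_iff]; omega)).symm⟩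
      have hβ : β.degree = N := by
        simpa using hα
      have hd : ofSymbol (MvPolynomial.pderiv i p) = 0 := ext fun f => by
        have := ofSymbol_coord_mul i p f
        simpa [hp] using this.symm
      have h0 := ih β _ hβ hd
      rw [MvPolynomial.coeff_pderiv] at h0
      have hu : IsUnit ((β i : AnalyticGerm x) + 1) := by
        have : IsUnit (algebraMap ℂ (AnalyticGerm x) ((β i : ℂ) + 1)) :=
          (IsUnit.mk0 _ (by exact_mod_cast Nat.succ_ne_zero (β i))).map _
        simpa using this
      exact hu.mul_left_eq_zero.1 h0
  intro p hp
  ext α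
  rw [key _ α p rfl hp, MvPolynomial.coeff_zero]

/-- Symbols all of whose monomials have degree at most `k`, where `k` is any integer. -/
def symbolLE (x : Fin n → ℝ) (k : ℤ) :
    Submodule (AnalyticGerm x) (MvPolynomial (Fin n) (AnalyticGerm x)) :=
  MvPolynomial.restrictSupport _ {α | (α.degree : ℤ) ≤ k}

theorem mem_symbolLE {k : ℤ} {p : MvPolynomial (Fin n) (AnalyticGerm x)} :
    p ∈ symbolLE x k ↔ ∀ α ∈ p.support, (α.degree : ℤ) ≤ k := Iff.rfl

theorem monomial_mem_symbolLE {k : ℤ} {α : Fin n →₀ ℕ} (h : (α.degree : ℤ) ≤ k)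
    (c : AnalyticGerm x) : MvPolynomial.monomial α c ∈ symbolLE x k := by
  classical
  rw [mem_symbolLE]
  intro β hβ
  have := Finset.mem_singleton.1 (MvPolynomial.support_monomial_subset hβ)
  rwa [this]

theorem symbolLE_mono {k l : ℤ} (h : k ≤ l) : symbolLE x k ≤ symbolLE x l := by
  intro p hp
  rw [mem_symbolLE] at *
  exact fun α hα => (hp α hα).trans h

/-- The operators `∑ c_α ∂^α` of order at most `k` (auxiliary form). -/
def orderAux (x : Fin n → ℝ) (k : ℤ) : Submodule (AnalyticGerm x) (DiffOp x) :=
  (symbolLE x k).map ofSymbol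

theorem del_mul_mem_orderAux (i : Fin n) {k : ℤ} {P : DiffOp x} (hP : P ∈ orderAux x k) :
    del i * P ∈ orderAux x (k + 1) := by
  obtain ⟨p, hp, rfl⟩ := hP
  have hp' := mem_symbolLE.1 hp
  rw [p.as_sum, map_sum, Finset.mul_sum]
  refine Submodule.sum_mem _ fun α hα => ?_
  rw [ofSymbol_monomial, del_mul_smul, del_mul_polyDel, ← ofSymbol_monomial, ← ofSymbol_monomial,
    ← map_add]
  refine Submodule.mem_map_of_mem (add_mem ?_ ?_)
  · refine monomial_mem_symbolLE ?_ _
    have := hp' α hα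
    simpa using this
  · refine monomial_mem_symbolLE ?_ _
    have := hp' α hα
    omega

theorem polyDel_mul_mem_orderAux (N : ℕ) : ∀ (α : Fin n →₀ ℕ) {k : ℤ} {P : DiffOp x},
    α.degree = N → P ∈ orderAux x k →
      polyDel (MvPolynomial.monomial α 1) * P ∈ orderAux x (N + k) := by
  induction N with
  | zero =>
    intro α k P hα hP
    rw [Finsupp.degree_eq_zero_iff] at hα
    subst hα
    have : polyDel (x := x) (MvPolynomial.monomial 0 1) = 1 := map_one polyDel
    simpa [this] using hP
  | succ N ih =>
    intro α k P hα hP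
    obtain ⟨i, hi⟩ : ∃ i, α i ≠ 0 := by
      by_contra! h
      have : α = 0 := Finsupp.ext h
      simp [this] at hα
    obtain ⟨β, rfl⟩ : ∃ β, α = β + Finsupp.single i 1 :=
      ⟨α - Finsupp.single i 1, (tsub_add_cancel_of_le (by
        rw [Finsupp.single_le_iff]; omega)).symm⟩
    have hβ : β.degree = N := by
      simpa using hα
    rw [← del_mul_polyDel, mul_assoc]
    have := del_mul_mem_orderAux i (ih β hβ hP)
    convert this using 2
    push_cast
    ring

theorem mul_mem_orderAux {k l : ℤ} {P Q : DiffOp x} (hP : P ∈ orderAux x k)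
    (hQ : Q ∈ orderAux x l) : P * Q ∈ orderAux x (k + l) := by
  obtain ⟨p, hp, rfl⟩ := hP
  have hp' := mem_symbolLE.1 hp
  rw [p.as_sum, map_sum, Finset.sum_mul]
  refine Submodule.sum_mem _ fun α hα => ?_
  rw [ofSymbol_monomial, smul_mul_assoc]
  refine Submodule.smul_mem _ _ ?_
  refine Submodule.map_mono (symbolLE_mono ?_) (polyDel_mul_mem_orderAux _ α rfl hQ)
  have := hp' α hα
  omega

theorem ofSymbol_C (f : AnalyticGerm x) : ofSymbol (MvPolynomial.C f) = ofFun f := by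
  have h : polyDel (x := x) (MvPolynomial.monomial 0 1) = 1 := map_one polyDel
  rw [MvPolynomial.C_apply, ofSymbol_monomial, h, smul_def, mul_one]

theorem ofSymbol_X (i : Fin n) : ofSymbol (x := x) (MvPolynomial.X i) = del i := by
  rw [MvPolynomial.X, ofSymbol_monomial, one_smul]
  exact polyDel_X i

theorem ofSymbol_surjective : Function.Surjective (ofSymbol (x := x)) := by
  have mem : ∀ P : DiffOp x, P ∈ LinearMap.range (ofSymbol (x := x)) ↔ ∃ k, P ∈ orderAux x k := by
    intro P
    constructor
    · rintro ⟨p, rfl⟩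
      refine ⟨p.totalDegree, Submodule.mem_map_of_mem (mem_symbolLE.2 fun α hα => ?_)⟩
      exact_mod_cast MvPolynomial.le_totalDegree hα
    · rintro ⟨k, p, -, rfl⟩
      exact ⟨p, rfl⟩
  rintro ⟨P, hP⟩
  suffices h : (⟨P, hP⟩ : DiffOp x) ∈ LinearMap.range (ofSymbol (x := x)) from h
  change P ∈ Algebra.adjoin ℂ _ at hP
  induction hP using Algebra.adjoin_induction with
  | mem P h =>
    obtain ⟨f, rfl⟩ | ⟨i, rfl⟩ := h
    · exact ⟨_, ofSymbol_C f⟩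
    · exact ⟨_, ofSymbol_X i⟩
  | algebraMap r =>
    refine ⟨_, (ofSymbol_C (algebraMap ℂ (AnalyticGerm x) r)).trans ?_⟩
    exact ext fun g => (Algebra.smul_def r g).symm
  | add P Q hP hQ h1 h2 => exact add_mem h1 h2
  | mul P Q hP hQ h1 h2 =>
    obtain ⟨k, h1⟩ := (mem _).1 h1
    obtain ⟨l, h2⟩ := (mem _).1 h2
    exact (mem _).2 ⟨k + l, mul_mem_orderAux h1 h2⟩

/-- The full symbol: every `P ∈ D` is uniquely of the form `∑ c_α ∂^α`, and its full symbol is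
`∑ c_α ξ^α ∈ O[ξ₁, …, ξₙ]`. -/
def fullSymbol (x : Fin n → ℝ) :
    DiffOp x ≃ₗ[AnalyticGerm x] MvPolynomial (Fin n) (AnalyticGerm x) :=
  (LinearEquiv.ofBijective ofSymbol ⟨ofSymbol_injective, ofSymbol_surjective⟩).symm

theorem fullSymbol_ofSymbol (p : MvPolynomial (Fin n) (AnalyticGerm x)) :
    fullSymbol x (ofSymbol p) = p :=
  (LinearEquiv.ofBijective ofSymbol ⟨ofSymbol_injective, ofSymbol_surjective⟩).symm_apply_apply p

theorem ofSymbol_fullSymbol (P : DiffOp x) : ofSymbol (fullSymbol x P) = P :=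
  (LinearEquiv.ofBijective ofSymbol ⟨ofSymbol_injective, ofSymbol_surjective⟩).apply_symm_apply P

/-- `D_k`: the differential operators of order at most `k`, for `k ∈ ℤ`
(so that `D_k = 0` for `k < 0`). -/
def orderLE (x : Fin n → ℝ) (k : ℤ) : Submodule (AnalyticGerm x) (DiffOp x) where
  carrier := {P | ∀ α, (fullSymbol x P).coeff α ≠ 0 → (α.degree : ℤ) ≤ k}
  zero_mem' := by simp
  add_mem' := by
    intro P Q hP hQ α hα
    by_cases h : (fullSymbol x P).coeff α = 0
    · exact hQ α fun h' => hα (by simp [h, h'])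
    · exact hP α h
  smul_mem' := by
    intro f P hP α hα
    exact hP α fun h => hα (by simp [h])

theorem orderLE_eq (k : ℤ) : orderLE x k = orderAux x k := by
  ext P
  constructor
  · intro h
    exact ⟨fullSymbol x P, mem_symbolLE.2 fun α hα => h α (MvPolynomial.mem_support_iff.1 hα),
      ofSymbol_fullSymbol P⟩
  · rintro ⟨p, hp, rfl⟩ α hα
    rw [fullSymbol_ofSymbol] at hα
    exact mem_symbolLE.1 hp α (MvPolynomial.mem_support_iff.2 hα)

theorem mul_mem_orderLE {k l : ℤ} {P Q : DiffOp x} (hP : P ∈ orderLE x k)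
    (hQ : Q ∈ orderLE x l) : P * Q ∈ orderLE x (k + l) := by
  rw [orderLE_eq] at *
  exact mul_mem_orderAux hP hQ

theorem orderLE_mono {k l : ℤ} (h : k ≤ l) : orderLE x k ≤ orderLE x l :=
  fun _ hP α hα => (hP α hα).trans h

theorem exists_mem_orderLE (P : DiffOp x) : ∃ k, P ∈ orderLE x k :=
  ⟨(fullSymbol x P).totalDegree, fun α hα => by
    exact_mod_cast MvPolynomial.le_totalDegree (MvPolynomial.mem_support_iff.2 hα)⟩

theorem del_mem_orderLE (i : Fin n) : del (x := x) i ∈ orderLE x 1 := by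
  rw [orderLE_eq, ← ofSymbol_X]
  refine Submodule.mem_map_of_mem (monomial_mem_symbolLE ?_ _)
  simp

/-- The homogeneous part of degree `d ∈ ℤ` of the full symbol of `P`
(zero when there are no terms of degree `d`, in particular when `d < 0`). -/
def symbolPart (d : ℤ) (P : DiffOp x) : MvPolynomial (Fin n) (AnalyticGerm x) :=
  if 0 ≤ d then MvPolynomial.homogeneousComponent d.toNat (fullSymbol x P) else 0

/-- The value at the point `x` and the covector `ξ` of the part of degree `d` of the symbol. -/
def symbolAt (d : ℤ) (P : DiffOp x) (ξ : Fin n → ℂ) : ℂ :=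
  MvPolynomial.eval₂ value ξ (symbolPart d P)

end DiffOp

open DiffOp

/-! ## Filtered modules -/

/-- A filtration of a left `D`-module `M`: an increasing exhaustive sequence of `O`-submodules
`M_k`, `k ∈ ℤ`, with `D_i M_k ⊆ M_{i + k}`. -/
structure DFiltration {n : ℕ} (x : Fin n → ℝ) (M : Type*) [AddCommGroup M]
    [Module (AnalyticGerm x) M] [Module (DiffOp x) M]
    [IsScalarTower (AnalyticGerm x) (DiffOp x) M] where
  /-- The `O`-submodule `M_k`. -/
  piece : ℤ → Submodule (AnalyticGerm x) M
  mono : Monotone piece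
  exhaustive : ∀ m, ∃ k, m ∈ piece k
  smul_mem : ∀ (i k : ℤ) (a : DiffOp x) (m : M), a ∈ orderLE x i → m ∈ piece k →
    a • m ∈ piece (i + k)

/-- The filtration of the free module `D^r` generated by a shift vector `ρ ∈ ℤ^r`: the element
`(a₁, …, a_r)` belongs to the `k`-th piece if and only if `ord a_j + ρ_j ≤ k` for all `j`. -/
def shiftFiltration {n : ℕ} (x : Fin n → ℝ) {r : ℕ} (ρ : Fin r → ℤ) :
    DFiltration x (Fin r → DiffOp x) where
  piece k := Submodule.pi Set.univ fun j => orderLE x (k - ρ j)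
  mono := fun k l h a ha j hj => orderLE_mono (by omega) (ha j hj)
  exhaustive a := by
    choose f hf using fun j => exists_mem_orderLE (a j)
    obtain ⟨K, hK⟩ : ∃ K, ∀ j, f j + ρ j ≤ K := by
      obtain ⟨K, hK⟩ := (Set.finite_range fun j => f j + ρ j).bddAbove
      exact ⟨K, fun j => hK ⟨j, rfl⟩⟩
    refine ⟨K, fun j _ => orderLE_mono ?_ (hf j)⟩
    have := hK j
    omega
  smul_mem i k a m ha hm j hj := by
    have := mul_mem_orderLE ha (hm j hj)
    rwa [← add_sub_assoc] at this

/-- A morphism of filtered modules is strict if `α(E_k) = α(E) ∩ F_k` for all `k ∈ ℤ`;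
in particular it agrees with the filtrations: `α(E_k) ⊆ F_k`. -/
def IsStrict {n : ℕ} {x : Fin n → ℝ} {E F : Type*}
    [AddCommGroup E] [Module (AnalyticGerm x) E] [Module (DiffOp x) E]
    [IsScalarTower (AnalyticGerm x) (DiffOp x) E]
    [AddCommGroup F] [Module (AnalyticGerm x) F] [Module (DiffOp x) F]
    [IsScalarTower (AnalyticGerm x) (DiffOp x) F]
    (FE : DFiltration x E) (FF : DFiltration x F) (α : E →ₗ[DiffOp x] F) : Prop :=
  ∀ k : ℤ, α '' (FE.piece k : Set E) = Set.range α ∩ (FF.piece k : Set F)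

namespace DFiltration

variable {n : ℕ} {x : Fin n → ℝ} {M : Type*} [AddCommGroup M]
  [Module (AnalyticGerm x) M] [Module (DiffOp x) M]
  [IsScalarTower (AnalyticGerm x) (DiffOp x) M]

/-- The quotient `M_k / M_{k-1}`. -/
abbrev GrPiece (F : DFiltration x M) (k : ℤ) : Type _ :=
  F.piece k ⧸ (F.piece (k - 1)).submoduleOf (F.piece k)

/-- The associated graded module `gr M = ⨁ M_k / M_{k-1}`, as an `O`-module. -/
abbrev Gr (F : DFiltration x M) : Type _ := ⨁ k : ℤ, F.GrPiece k

theorem del_smul_smul (i : Fin n) (f : AnalyticGerm x) (m : M) :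
    del (x := x) i • f • m = f • del (x := x) i • m + (partialD i f) • m := by
  have h : ∀ (f : AnalyticGerm x) (m : M), f • m = (f • (1 : DiffOp x)) • m := fun f m => by
    rw [smul_assoc, one_smul]
  rw [h f m, ← mul_smul, del_mul_smul, add_smul, smul_assoc, mul_one, smul_assoc, one_smul]

/-- The map `M_k / M_{k-1} → M_{k+1} / M_k` induced by `m ↦ ∂ᵢ m`. -/
def xiPiece (F : DFiltration x M) (i : Fin n) (k : ℤ) :
    F.GrPiece k →ₗ[AnalyticGerm x] F.GrPiece (k + 1) :=
  Submodule.liftQ _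
    { toFun := fun m => Submodule.Quotient.mk
        ⟨del (x := x) i • (m : M), by
          have := F.smul_mem 1 k _ _ (del_mem_orderLE i) m.2
          rwa [add_comm] at this⟩
      map_add' := fun m m' => by
        rw [← Submodule.Quotient.mk_add]
        congr 1
        exact Subtype.ext (smul_add _ _ _)
      map_smul' := fun f m => by
        rw [RingHom.id_apply, ← Submodule.Quotient.mk_smul, Submodule.Quotient.eq]
        have h := del_smul_smul i f (m : M)
        have h2 : (partialD i f) • (m : M) ∈ F.piece (k + 1 - 1) := by
          rw [add_sub_cancel_right]
          exact Submodule.smul_mem _ _ m.2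
        have h3 : del (x := x) i • f • (m : M) - f • del (x := x) i • (m : M)
            = (partialD i f) • (m : M) := by rw [h]; abel
        rw [← h3] at h2
        exact h2 }
    (by
      intro m hm
      replace hm : (m : M) ∈ F.piece (k - 1) := hm
      rw [LinearMap.mem_ker]
      refine (Submodule.Quotient.mk_eq_zero _).2 ?_
      change del (x := x) i • (m : M) ∈ F.piece (k + 1 - 1)
      have := F.smul_mem 1 (k - 1) _ _ (del_mem_orderLE i) hm
      rwa [show 1 + (k - 1) = k + 1 - 1 by ring] at this)

/-- The action of `ξᵢ`, the class of `∂ᵢ` in `gr D = O[ξ₁, …, ξₙ]`, on `gr M`: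
it sends the class of `m ∈ M_k` to the class of `∂ᵢ m ∈ M_{k+1}`. -/
def xi (F : DFiltration x M) (i : Fin n) : Module.End (AnalyticGerm x) F.Gr :=
  DirectSum.toModule (AnalyticGerm x) ℤ F.Gr fun k =>
    (DirectSum.lof (AnalyticGerm x) ℤ (fun k => F.GrPiece k) (k + 1)).comp (F.xiPiece i k)

theorem xi_lof (F : DFiltration x M) (i : Fin n) (k : ℤ) (m : F.GrPiece k) :
    F.xi i (DirectSum.lof (AnalyticGerm x) ℤ (fun k => F.GrPiece k) k m) =
      DirectSum.lof (AnalyticGerm x) ℤ (fun k => F.GrPiece k) (k + 1) (F.xiPiece i k m) := by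
  rw [xi, DirectSum.toModule_lof]
  rfl

theorem xi_comm (F : DFiltration x M) (i j : Fin n) : F.xi i * F.xi j = F.xi j * F.xi i := by
  refine DirectSum.linearMap_ext _ fun k => ?_
  refine LinearMap.ext fun m => ?_
  obtain ⟨m, rfl⟩ := Submodule.Quotient.mk_surjective _ m
  simp only [LinearMap.comp_apply, Module.End.mul_apply, xi_lof]
  congr 1
  refine congrArg Submodule.Quotient.mk (Subtype.ext ?_)
  change del (x := x) i • del (x := x) j • (m : M) = del (x := x) j • del (x := x) i • (m : M)
  rw [← mul_smul, ← mul_smul, del_comm]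

/-- `gr M` is a module over `gr D = O[ξ₁, …, ξₙ]`. -/
instance (F : DFiltration x M) : Module (MvPolynomial (Fin n) (AnalyticGerm x)) F.Gr :=
  Module.compHom F.Gr (commEval (R := AnalyticGerm x) F.xi F.xi_comm).toRingHom

/-- The `ℂ`-vector space `gr M ⊗_O ℂ`. -/
def Fiber (F : DFiltration x M) : Type _ := ℂ ⊗[AnalyticGerm x] F.Gr

instance (F : DFiltration x M) : AddCommGroup F.Fiber :=
  inferInstanceAs (AddCommGroup (ℂ ⊗[AnalyticGerm x] F.Gr))

instance (F : DFiltration x M) : Module ℂ F.Fiber :=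
  inferInstanceAs (Module ℂ (ℂ ⊗[AnalyticGerm x] F.Gr))

/-- The action of `ξᵢ` on `gr M ⊗_O ℂ`. -/
def fiberXi (F : DFiltration x M) (i : Fin n) : Module.End ℂ F.Fiber :=
  (F.xi i).baseChange ℂ

theorem fiberXi_comm (F : DFiltration x M) (i j : Fin n) :
    F.fiberXi i * F.fiberXi j = F.fiberXi j * F.fiberXi i := by
  have h := congrArg (LinearMap.baseChange ℂ) (F.xi_comm i j)
  rwa [LinearMap.baseChange_mul, LinearMap.baseChange_mul] at h

/-- `gr M ⊗_O ℂ` is a module over the polynomial algebra `A = D ⊗_O ℂ = ℂ[ξ₁, …, ξₙ]`. -/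
instance (F : DFiltration x M) : Module (MvPolynomial (Fin n) ℂ) F.Fiber :=
  Module.compHom F.Fiber (commEval (R := ℂ) F.fiberXi F.fiberXi_comm).toRingHom

/-- The characteristic variety `V(M) ⊆ ℂⁿ`: the points whose maximal ideal belongs to the support
of the `A`-module `gr M ⊗_O ℂ`. -/
def charVariety (F : DFiltration x M) : Set (Fin n → ℂ) :=
  {ζ | MvPolynomial.pointToPoint (k := ℂ) ζ ∈
    Module.support (MvPolynomial (Fin n) ℂ) F.Fiber}

/-- The filtered module `M` is elliptic: its characteristic variety contains no real point
`ξ ≠ 0`. -/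
def IsElliptic (F : DFiltration x M) : Prop :=
  ∀ ξ : Fin n → ℝ, ξ ≠ 0 → (fun i => (ξ i : ℂ)) ∉ F.charVariety

end DFiltration

/-! ## Strict free resolutions and their symbols -/

/-- A strict resolution `⋯ → D^{ρ₂} → D^{ρ₁} → D^{ρ₀} → M → 0` of a filtered `D`-module `M` by free
modules of finite rank, filtered by shift vectors. The morphisms between the free modules are
written as right multiplications of rows by matrices with entries in `D`. Finite resolutions are
those with `rank k = 0` for large `k`. -/
structure StrictFreeResolution {n : ℕ} {x : Fin n → ℝ} {M : Type*} [AddCommGroup M]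
    [Module (AnalyticGerm x) M] [Module (DiffOp x) M]
    [IsScalarTower (AnalyticGerm x) (DiffOp x) M] (F : DFiltration x M) where
  rank : ℕ → ℕ
  shift : ∀ k, Fin (rank k) → ℤ
  matrix : ∀ k, Matrix (Fin (rank (k + 1))) (Fin (rank k)) (DiffOp x)
  aug : (Fin (rank 0) → DiffOp x) →ₗ[DiffOp x] M
  aug_surjective : Function.Surjective aug
  exact_aug : Function.Exact (matrix 0).vecMulLinear aug
  exact_matrix : ∀ k, Function.Exact (matrix (k + 1)).vecMulLinear (matrix k).vecMulLinear
  strict_aug : IsStrict (shiftFiltration x (shift 0)) F aug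
  strict_matrix : ∀ k, IsStrict (shiftFiltration x (shift (k + 1))) (shiftFiltration x (shift k))
    (matrix k).vecMulLinear

namespace StrictFreeResolution

variable {n : ℕ} {x : Fin n → ℝ} {M : Type*} [AddCommGroup M]
  [Module (AnalyticGerm x) M] [Module (DiffOp x) M]
  [IsScalarTower (AnalyticGerm x) (DiffOp x) M] {F : DFiltration x M}

/-- The `k`-th matrix of the principal symbol at `(x, ξ)`: for the matrix `(p_ij)` with row shifts
`σ_i` and column shifts `ρ_j` its entries are the values at `(x, ξ)` of the homogeneous parts of
`p_ij` of degree `σ_i - ρ_j`. -/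
def symbol (R : StrictFreeResolution F) (k : ℕ) (ξ : Fin n → ℂ) :
    Matrix (Fin (R.rank (k + 1))) (Fin (R.rank k)) ℂ :=
  Matrix.of fun i j => symbolAt (R.shift (k + 1) i - R.shift k j) (R.matrix k i j) ξ

/-- The resolution is an elliptic complex: at each real `ξ ≠ 0` its principal symbol
`⋯ → ℂ^{r₂} → ℂ^{r₁} → ℂ^{r₀} → 0` is exact at every term. -/
def IsElliptic (R : StrictFreeResolution F) : Prop :=
  ∀ ξ : Fin n → ℝ, ξ ≠ 0 →
    Function.Surjective (R.symbol 0 fun i => (ξ i : ℂ)).vecMulLinear ∧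
      ∀ k, Function.Exact (R.symbol (k + 1) fun i => (ξ i : ℂ)).vecMulLinear
        (R.symbol k fun i => (ξ i : ℂ)).vecMulLinear

end StrictFreeResolution

end

/-!
Write `S = O[ξ₁, …, ξₙ]`, and for a point `ζ ∈ ℂⁿ` let `S → ℂ` be the evaluation at `(x, ζ)`.

The principal symbol is multiplicative (`DiffOp.symbolPart_mul`), so the symbols of the matrices of
the resolution, taken with coefficients in `O`, form a complex of free `S`-modules. Strictness makes
this complex exact at every term except the last one (`DiffOp.mem_range_symbolMatrix`): a
homogeneous cycle lifts to a row of operators whose image has lower order, strictness corrects the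
lift to a row which is annihilated without changing the symbol, and the correction is a boundary.

It remains to specialize at `(x, ζ)` with `ζ` outside the characteristic variety. At the last term
the specialization is surjective (`DFiltration.symbolMatrix_surjective`): a linear form vanishing on
the image induces an `O`-linear form on `gr M` on which `ξᵢ` acts as `ζᵢ`, and such a form vanishes
because each element of `gr M ⊗_O ℂ` is killed by a polynomial which does not vanish at `ζ`. Lifting
a right inverse of the specialization to `S`, one obtains `t ∈ S` with value `1` at `(x, ζ)` such
that multiplication by `t` factors through the first symbol matrix. By exactness over `S` this
extends to a null homotopy of multiplication by `t` on the whole complex, and the value of the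
homotopy at `(x, ζ)` contracts the specialized complex (`Matrix.exact_map_of_surjective`). This is
an elementary form of the statement that an exact complex of free modules, bounded on the right,
stays exact under base change.
-/

noncomputable section

open AnalyticGerm DiffOp

/-! ### Homogeneous parts of integral degree -/

namespace MvPolynomial

variable {σ R : Type*} [CommRing R]

/-- The homogeneous part of degree `d ∈ ℤ` of a polynomial, zero for `d < 0`. Integral degrees
are needed because the degrees below are differences of shifts. -/
def homogPart (d : ℤ) : MvPolynomial σ R →ₗ[R] MvPolynomial σ R :=
  if 0 ≤ d then homogeneousComponent d.toNat else 0

theorem coeff_homogPart (d : ℤ) (p : MvPolynomial σ R) (α : σ →₀ ℕ) :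
    coeff α (homogPart d p) = if (α.degree : ℤ) = d then coeff α p else 0 := by
  unfold homogPart
  by_cases hd : 0 ≤ d
  · rw [if_pos hd, coeff_homogeneousComponent]
    exact if_congr (by omega) rfl rfl
  · rw [if_neg hd, if_neg (by omega)]
    simp

theorem homogPart_monomial (d : ℤ) (α : σ →₀ ℕ) (c : R) :
    homogPart d (monomial α c) = if (α.degree : ℤ) = d then monomial α c else 0 := by
  classical
  ext β
  rw [coeff_homogPart]
  by_cases h : α = β
  · subst h
    split_ifs <;> simp
  · split_ifs <;> simp [coeff_monomial, h]

theorem homogPart_homogPart_self (d : ℤ) (p : MvPolynomial σ R) :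
    homogPart d (homogPart d p) = homogPart d p := by
  ext α
  simp only [coeff_homogPart]
  split_ifs <;> rfl

theorem homogPart_mul_homogPart (m d : ℤ) (p q : MvPolynomial σ R) :
    homogPart m (p * homogPart d q) = homogPart (m - d) p * homogPart d q := by
  induction p using induction_on' with
  | add p₁ p₂ h₁ h₂ => rw [add_mul, map_add, map_add, add_mul, h₁, h₂]
  | monomial α a =>
    induction q using induction_on' with
    | add q₁ q₂ h₁ h₂ => rw [map_add, mul_add, map_add, mul_add, h₁, h₂]
    | monomial β b =>
      rw [homogPart_monomial, homogPart_monomial]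
      by_cases hβ : (β.degree : ℤ) = d
      · rw [if_pos hβ, monomial_mul, homogPart_monomial, map_add]
        by_cases hα : (α.degree : ℤ) = m - d
        · rw [if_pos hα, if_pos (by push_cast; omega), monomial_mul]
        · rw [if_neg hα, if_neg (by push_cast; omega), zero_mul]
      · simp [if_neg hβ]

/-- A vector of polynomials is a finite sum of vectors which are homogeneous for the grading of
the free module with shifts `ρ`. -/
theorem exists_eq_sum_homogPart {r : ℕ} (ρ : Fin r → ℤ) (v : Fin r → MvPolynomial σ R) :
    ∃ s : Finset ℤ, v = ∑ m ∈ s, fun j => homogPart (m - ρ j) (v j) := by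
  classical
  refine ⟨Finset.univ.biUnion fun j => (v j).support.image fun α => (α.degree : ℤ) + ρ j, ?_⟩
  ext j α
  have h : ∀ m : ℤ, ((α.degree : ℤ) = m - ρ j) ↔ ((α.degree : ℤ) + ρ j = m) := by
    intro m
    omega
  simp only [Finset.sum_apply, coeff_sum, coeff_homogPart, h, Finset.sum_ite_eq]
  split_ifs with hs
  · rfl
  · by_contra hα
    exact hs (Finset.mem_biUnion.2 ⟨j, Finset.mem_univ j,
      Finset.mem_image.2 ⟨α, mem_support_iff.2 hα, rfl⟩⟩)

end MvPolynomial

open MvPolynomial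

/-! ### Principal symbols of differential operators -/

namespace DiffOp

variable {n : ℕ} {x : Fin n → ℝ}

theorem symbolPart_eq_homogPart (d : ℤ) (P : DiffOp x) :
    symbolPart d P = homogPart d (fullSymbol x P) := by
  unfold symbolPart homogPart
  split_ifs <;> simp

/-- `symbolPart` as an `O`-linear map. -/
def symbolPartL (x : Fin n → ℝ) (d : ℤ) :
    DiffOp x →ₗ[AnalyticGerm x] MvPolynomial (Fin n) (AnalyticGerm x) :=
  homogPart d ∘ₗ (fullSymbol x).toLinearMap

theorem symbolPartL_apply (d : ℤ) (P : DiffOp x) : symbolPartL x d P = symbolPart d P :=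
  (symbolPart_eq_homogPart d P).symm

theorem symbolPart_ofSymbol (d : ℤ) (p : MvPolynomial (Fin n) (AnalyticGerm x)) :
    symbolPart d (ofSymbol p) = homogPart d p := by
  rw [symbolPart_eq_homogPart, fullSymbol_ofSymbol]

theorem ofSymbol_mem_orderLE {k : ℤ} {p : MvPolynomial (Fin n) (AnalyticGerm x)}
    (hp : p ∈ symbolLE x k) : ofSymbol p ∈ orderLE x k := by
  rw [orderLE_eq]
  exact Submodule.mem_map_of_mem hp

theorem ofSymbol_homogPart_mem_orderLE (k : ℤ) (p : MvPolynomial (Fin n) (AnalyticGerm x)) :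
    ofSymbol (homogPart k p) ∈ orderLE x k := by
  refine ofSymbol_mem_orderLE (mem_symbolLE.2 fun α hα => ?_)
  rw [mem_support_iff, coeff_homogPart] at hα
  by_contra h
  exact hα (if_neg (by omega))

theorem symbolPart_eq_zero_of_lt {k d : ℤ} (h : k < d) {P : DiffOp x} (hP : P ∈ orderLE x k) :
    symbolPart d P = 0 := by
  rw [symbolPart_eq_homogPart]
  ext α
  rw [coeff_homogPart, coeff_zero]
  split_ifs with hd
  · by_contra hα
    have := hP α hα
    omega
  · rfl

theorem mem_orderLE_pred {k : ℤ} {P : DiffOp x} (hP : P ∈ orderLE x k)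
    (h : symbolPart k P = 0) : P ∈ orderLE x (k - 1) := by
  intro α hα
  have h1 := hP α hα
  rw [symbolPart_eq_homogPart] at h
  have h2 := congrArg (coeff α) h
  rw [coeff_homogPart, coeff_zero] at h2
  by_contra h3
  rw [if_pos (by omega)] at h2
  exact hα h2

/-- The elements of `D_l` are sums of terms `c ∂^α` with `|α| ≤ l`. -/
theorem orderLE_induction {l : ℤ} {p : DiffOp x → Prop} (hadd : ∀ P Q, p P → p Q → p (P + Q))
    (hzero : p 0)
    (hmon : ∀ (α : Fin n →₀ ℕ) (c : AnalyticGerm x), (α.degree : ℤ) ≤ l →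
      p (ofSymbol (monomial α c))) {P : DiffOp x} (hP : P ∈ orderLE x l) : p P := by
  rw [orderLE_eq] at hP
  obtain ⟨q, hq, rfl⟩ := hP
  rw [q.as_sum, map_sum]
  exact Finset.sum_induction _ p hadd hzero fun α hα => hmon α _ (mem_symbolLE.1 hq α hα)

theorem symbolPart_add (d : ℤ) (P Q : DiffOp x) :
    symbolPart d (P + Q) = symbolPart d P + symbolPart d Q := by
  simp only [← symbolPartL_apply, map_add]

theorem symbolPart_smul (d : ℤ) (f : AnalyticGerm x) (P : DiffOp x) :
    symbolPart d (f • P) = f • symbolPart d P := by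
  simp only [← symbolPartL_apply, map_smul]

theorem symbolPart_zero (d : ℤ) : symbolPart d (0 : DiffOp x) = 0 := by
  simp only [← symbolPartL_apply, map_zero]

theorem symbolPart_del_mul (i : Fin n) {l : ℤ} {P : DiffOp x} (hP : P ∈ orderLE x l) :
    symbolPart (l + 1) (del i * P) = X i * symbolPart l P := by
  refine orderLE_induction (p := fun P => symbolPart (l + 1) (del i * P) = X i * symbolPart l P)
    (fun P Q h₁ h₂ => ?_) ?_ (fun α c hα => ?_) hP
  · rw [mul_add, symbolPart_add, symbolPart_add, h₁, h₂, mul_add]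
  · rw [mul_zero, symbolPart_zero, symbolPart_zero, mul_zero]
  · have e : del i * ofSymbol (monomial α c) =
        ofSymbol (monomial (α + Finsupp.single i 1) c) + ofSymbol (monomial α (partialD i c)) := by
      rw [ofSymbol_monomial, del_mul_smul, del_mul_polyDel, ← ofSymbol_monomial,
        ← ofSymbol_monomial]
    rw [e, symbolPart_add, symbolPart_ofSymbol, symbolPart_ofSymbol, symbolPart_ofSymbol,
      homogPart_monomial, homogPart_monomial, homogPart_monomial, map_add, Finsupp.degree_single,
      if_neg (show ¬ (α.degree : ℤ) = l + 1 by omega), add_zero, add_comm α]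
    by_cases h : (α.degree : ℤ) = l
    · rw [if_pos h, if_pos (by push_cast; omega), X, monomial_mul, one_mul]
    · rw [if_neg h, if_neg (by push_cast; omega), mul_zero]

theorem symbolPart_polyDel_mul (α : Fin n →₀ ℕ) {l : ℤ} {P : DiffOp x} (hP : P ∈ orderLE x l) :
    polyDel (monomial α 1) * P ∈ orderLE x (α.degree + l) ∧
      symbolPart (α.degree + l) (polyDel (monomial α 1) * P) =
        monomial α 1 * symbolPart l P := by
  induction α using Finsupp.induction_linear generalizing l P with
  | zero =>
    have h : polyDel (x := x) (monomial 0 1) = 1 := map_one polyDel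
    have h' : (monomial 0 1 : MvPolynomial (Fin n) (AnalyticGerm x)) = 1 := rfl
    simpa [h, h'] using hP
  | add α β hα hβ =>
    obtain ⟨h₁, h₂⟩ := hβ hP
    obtain ⟨h₃, h₄⟩ := hα h₁
    have e : polyDel (x := x) (monomial (α + β) 1) * P =
        polyDel (monomial α 1) * (polyDel (monomial β 1) * P) := by
      rw [← mul_assoc, ← map_mul, monomial_mul, one_mul]
    have e' : (((α + β).degree : ℕ) : ℤ) + l = α.degree + (β.degree + l) := by
      rw [map_add]
      push_cast
      ring
    rw [e, e']
    refine ⟨h₃, ?_⟩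
    rw [h₄, h₂, ← mul_assoc, monomial_mul, one_mul]
  | single i k =>
    induction k with
    | zero =>
      have h : polyDel (x := x) (monomial 0 1) = 1 := map_one polyDel
      have h' : (monomial 0 1 : MvPolynomial (Fin n) (AnalyticGerm x)) = 1 := rfl
      simpa [h, h'] using hP
    | succ k ih =>
      obtain ⟨h₁, h₂⟩ := ih
      have h₃ := symbolPart_del_mul i h₁
      have h₄ := mul_mem_orderLE (del_mem_orderLE i) h₁
      rw [← mul_assoc, del_mul_polyDel, ← Finsupp.single_add] at h₃ h₄
      have e : (((Finsupp.single i (k + 1)).degree : ℕ) : ℤ) + l =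
          (Finsupp.single i k).degree + l + 1 := by
        simp only [Finsupp.degree_single]
        push_cast
        ring
      rw [e]
      refine ⟨by rwa [add_comm 1] at h₄, ?_⟩
      rw [h₃, h₂, ← mul_assoc, X, monomial_mul, one_mul, ← Finsupp.single_add, add_comm 1]

/-- The principal symbol is multiplicative: this identifies `gr D` with `O[ξ]`. -/
theorem symbolPart_mul {k l : ℤ} {P Q : DiffOp x} (hP : P ∈ orderLE x k)
    (hQ : Q ∈ orderLE x l) : symbolPart (k + l) (P * Q) = symbolPart k P * symbolPart l Q := by
  refine orderLE_induction
    (p := fun P => symbolPart (k + l) (P * Q) = symbolPart k P * symbolPart l Q)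
    (fun P P' h₁ h₂ => ?_) ?_ (fun α c hα => ?_) hP
  · rw [add_mul, symbolPart_add, symbolPart_add, h₁, h₂, add_mul]
  · rw [zero_mul, symbolPart_zero, symbolPart_zero, zero_mul]
  · obtain ⟨h₁, h₂⟩ := symbolPart_polyDel_mul α hQ
    rw [ofSymbol_monomial, smul_mul_assoc, symbolPart_smul, ← ofSymbol_monomial,
      symbolPart_ofSymbol, homogPart_monomial]
    by_cases h : (α.degree : ℤ) = k
    · rw [if_pos h, ← h, h₂, ← smul_mul_assoc, smul_monomial, smul_eq_mul, mul_one]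
    · rw [if_neg h, symbolPart_eq_zero_of_lt (by omega) h₁, smul_zero, zero_mul]

/-- The principal symbol of degree `m` of a row in `D^ρ_m`, with entries the parts of degree
`m - ρ_j`. -/
def rowSymbol (x : Fin n → ℝ) {r : ℕ} (ρ : Fin r → ℤ) (m : ℤ) :
    (Fin r → DiffOp x) →ₗ[AnalyticGerm x] (Fin r → MvPolynomial (Fin n) (AnalyticGerm x)) :=
  LinearMap.pi fun j => symbolPartL x (m - ρ j) ∘ₗ LinearMap.proj j

theorem rowSymbol_apply {r : ℕ} (ρ : Fin r → ℤ) (m : ℤ) (a : Fin r → DiffOp x) (j : Fin r) :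
    rowSymbol x ρ m a j = symbolPart (m - ρ j) (a j) :=
  symbolPartL_apply _ _

theorem mem_shiftFiltration {r : ℕ} {ρ : Fin r → ℤ} {m : ℤ} {a : Fin r → DiffOp x} :
    a ∈ (shiftFiltration x ρ).piece m ↔ ∀ j, a j ∈ orderLE x (m - ρ j) :=
  ⟨fun h j => h j (Set.mem_univ j), fun h j _ => h j⟩

theorem rowSymbol_eq_zero_of_mem_pred {r : ℕ} {ρ : Fin r → ℤ} {m : ℤ} {a : Fin r → DiffOp x}
    (ha : a ∈ (shiftFiltration x ρ).piece (m - 1)) : rowSymbol x ρ m a = 0 := by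
  funext j
  rw [rowSymbol_apply]
  exact symbolPart_eq_zero_of_lt (by omega) (mem_shiftFiltration.1 ha j)

theorem mem_pred_of_rowSymbol_eq_zero {r : ℕ} {ρ : Fin r → ℤ} {m : ℤ} {a : Fin r → DiffOp x}
    (ha : a ∈ (shiftFiltration x ρ).piece m) (h : rowSymbol x ρ m a = 0) :
    a ∈ (shiftFiltration x ρ).piece (m - 1) := by
  refine mem_shiftFiltration.2 fun j => ?_
  have h₁ := congrFun h j
  rw [rowSymbol_apply] at h₁
  have h₂ := mem_orderLE_pred (mem_shiftFiltration.1 ha j) h₁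
  rwa [show m - ρ j - 1 = m - 1 - ρ j by ring] at h₂

theorem exists_rowSymbol_eq {r : ℕ} (ρ : Fin r → ℤ) (m : ℤ)
    (v : Fin r → MvPolynomial (Fin n) (AnalyticGerm x)) :
    ∃ a ∈ (shiftFiltration x ρ).piece m,
      rowSymbol x ρ m a = fun j => homogPart (m - ρ j) (v j) := by
  refine ⟨fun j => ofSymbol (homogPart (m - ρ j) (v j)),
    mem_shiftFiltration.2 fun j => ofSymbol_homogPart_mem_orderLE _ _, ?_⟩
  funext j
  rw [rowSymbol_apply, symbolPart_ofSymbol, homogPart_homogPart_self]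

end DiffOp

/-! ### Symbol sequences of strict exact sequences -/

namespace DiffOp

variable {n : ℕ} {x : Fin n → ℝ}

/-- The principal symbol, with entries in `O[ξ]`, of a matrix with row shifts `σ` and column
shifts `ρ`. -/
def symbolMatrix {s r : ℕ} (σ : Fin s → ℤ) (ρ : Fin r → ℤ)
    (A : Matrix (Fin s) (Fin r) (DiffOp x)) :
    Matrix (Fin s) (Fin r) (MvPolynomial (Fin n) (AnalyticGerm x)) :=
  Matrix.of fun i j => symbolPart (σ i - ρ j) (A i j)

theorem one_mem_orderLE : (1 : DiffOp x) ∈ orderLE x 0 := by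
  have h : ofSymbol (C (1 : AnalyticGerm x)) = 1 := by
    rw [ofSymbol_C]
    exact ext fun g => by simp
  rw [← h]
  exact ofSymbol_mem_orderLE (monomial_mem_symbolLE (by simp) _)

variable {t s r : ℕ} {τ : Fin t → ℤ} {σ : Fin s → ℤ} {ρ : Fin r → ℤ}
  {A : Matrix (Fin s) (Fin r) (DiffOp x)} {B : Matrix (Fin t) (Fin s) (DiffOp x)}

theorem vecMul_mem_of_isStrict
    (hA : IsStrict (shiftFiltration x σ) (shiftFiltration x ρ) A.vecMulLinear) {m : ℤ}
    {a : Fin s → DiffOp x} (ha : a ∈ (shiftFiltration x σ).piece m) :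
    Matrix.vecMul a A ∈ (shiftFiltration x ρ).piece m := by
  have h : A.vecMulLinear a ∈ A.vecMulLinear '' ((shiftFiltration x σ).piece m : Set _) :=
    ⟨a, ha, rfl⟩
  rw [hA m] at h
  exact h.2

theorem single_mem_shiftFiltration (σ : Fin s → ℤ) (i : Fin s) :
    (Pi.single i 1 : Fin s → DiffOp x) ∈ (shiftFiltration x σ).piece (σ i) := by
  refine mem_shiftFiltration.2 fun j => ?_
  by_cases hij : j = i
  · subst hij
    simpa using one_mem_orderLE
  · rw [Pi.single_eq_of_ne hij]
    exact zero_mem _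

/-- The rows of the matrix of a filtered morphism lie in the pieces given by the row shifts,
being the images of the standard basis vectors. -/
theorem row_mem_of_isStrict
    (hA : IsStrict (shiftFiltration x σ) (shiftFiltration x ρ) A.vecMulLinear) (i : Fin s) :
    A i ∈ (shiftFiltration x ρ).piece (σ i) := by
  have h := vecMul_mem_of_isStrict hA (single_mem_shiftFiltration σ i)
  rwa [Matrix.single_one_vecMul] at h

theorem rowSymbol_vecMul
    (hA : IsStrict (shiftFiltration x σ) (shiftFiltration x ρ) A.vecMulLinear) {m : ℤ}
    {a : Fin s → DiffOp x} (ha : a ∈ (shiftFiltration x σ).piece m) :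
    rowSymbol x ρ m (Matrix.vecMul a A) =
      Matrix.vecMul (rowSymbol x σ m a) (symbolMatrix σ ρ A) := by
  funext j
  rw [rowSymbol_apply, ← symbolPartL_apply]
  simp only [Matrix.vecMul, dotProduct, map_sum]
  refine Finset.sum_congr rfl fun i _ => ?_
  have h := symbolPart_mul (mem_shiftFiltration.1 ha i)
    (mem_shiftFiltration.1 (row_mem_of_isStrict hA i) j)
  rw [sub_add_sub_cancel] at h
  rw [symbolPartL_apply, h, rowSymbol_apply]
  rfl

theorem symbolMatrix_mul_eq_zero
    (hA : IsStrict (shiftFiltration x σ) (shiftFiltration x ρ) A.vecMulLinear)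
    (hB : IsStrict (shiftFiltration x τ) (shiftFiltration x σ) B.vecMulLinear)
    (hBA : Function.Exact B.vecMulLinear A.vecMulLinear) :
    symbolMatrix τ σ B * symbolMatrix σ ρ A = 0 := by
  refine Matrix.ext_row fun i => ?_
  have h₀ : Matrix.vecMul (B i) A = 0 := by
    refine (hBA _).2 ⟨Pi.single i 1, ?_⟩
    exact Matrix.single_one_vecMul i B
  have h := rowSymbol_vecMul hA (row_mem_of_isStrict hB i)
  have h₁ : rowSymbol x σ (τ i) (B i) = symbolMatrix τ σ B i := by
    funext j
    rw [rowSymbol_apply]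
    rfl
  rw [h₀, map_zero, h₁] at h
  exact h.symm

/-- A homogeneous relation between the symbols lifts to a row of operators whose image has lower
order; by strictness it can be corrected by a row of lower order, with the same symbol, so as to
be annihilated. -/
theorem rowSymbol_mem_range
    (hA : IsStrict (shiftFiltration x σ) (shiftFiltration x ρ) A.vecMulLinear)
    (hB : IsStrict (shiftFiltration x τ) (shiftFiltration x σ) B.vecMulLinear)
    (hBA : Function.Exact B.vecMulLinear A.vecMulLinear) {m : ℤ} {a : Fin s → DiffOp x}
    (ha : a ∈ (shiftFiltration x σ).piece m)
    (h : Matrix.vecMul (rowSymbol x σ m a) (symbolMatrix σ ρ A) = 0) :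
    rowSymbol x σ m a ∈ LinearMap.range (symbolMatrix τ σ B).vecMulLinear := by
  rw [← rowSymbol_vecMul hA ha] at h
  have h₁ := mem_pred_of_rowSymbol_eq_zero (vecMul_mem_of_isStrict hA ha) h
  obtain ⟨b, hb, hab⟩ : A.vecMulLinear a ∈
      A.vecMulLinear '' ((shiftFiltration x σ).piece (m - 1) : Set _) := by
    rw [hA (m - 1)]
    exact ⟨⟨a, rfl⟩, h₁⟩
  have hab' : A.vecMulLinear (a - b) = 0 := by rw [map_sub, hab, sub_self]
  obtain ⟨c, hc, hcab⟩ : a - b ∈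
      B.vecMulLinear '' ((shiftFiltration x τ).piece m : Set _) := by
    rw [hB m]
    exact ⟨(hBA _).1 hab',
      sub_mem ha ((shiftFiltration x σ).mono (sub_le_self m zero_le_one) hb)⟩
  refine ⟨rowSymbol x τ m c, ?_⟩
  have h₂ := rowSymbol_vecMul hB hc
  have h₃ : Matrix.vecMul c B = a - b := hcab
  rw [h₃, map_sub, rowSymbol_eq_zero_of_mem_pred hb, sub_zero] at h₂
  exact h₂.symm

theorem vecMul_homogPart_symbolMatrix (v : Fin s → MvPolynomial (Fin n) (AnalyticGerm x)) (m : ℤ)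
    (j : Fin r) : Matrix.vecMul (fun i => homogPart (m - σ i) (v i)) (symbolMatrix σ ρ A) j =
      homogPart (m - ρ j) (Matrix.vecMul v (symbolMatrix σ ρ A) j) := by
  simp only [Matrix.vecMul, dotProduct, map_sum]
  refine Finset.sum_congr rfl fun i _ => ?_
  rw [symbolMatrix, Matrix.of_apply, symbolPart_eq_homogPart, homogPart_mul_homogPart,
    sub_sub_sub_cancel_right]

theorem mem_range_symbolMatrix
    (hA : IsStrict (shiftFiltration x σ) (shiftFiltration x ρ) A.vecMulLinear)
    (hB : IsStrict (shiftFiltration x τ) (shiftFiltration x σ) B.vecMulLinear)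
    (hBA : Function.Exact B.vecMulLinear A.vecMulLinear)
    {v : Fin s → MvPolynomial (Fin n) (AnalyticGerm x)}
    (hv : Matrix.vecMul v (symbolMatrix σ ρ A) = 0) :
    v ∈ LinearMap.range (symbolMatrix τ σ B).vecMulLinear := by
  obtain ⟨S, hS⟩ := exists_eq_sum_homogPart σ v
  rw [hS]
  refine sum_mem fun m _ => ?_
  obtain ⟨a, ha, hav⟩ := exists_rowSymbol_eq σ m v
  rw [← hav]
  refine rowSymbol_mem_range hA hB hBA ha ?_
  rw [hav]
  funext j
  rw [vecMul_homogPart_symbolMatrix, hv]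
  simp

end DiffOp

/-! ### Evaluation of a contractible complex -/

/-- The inductive step for lifting a null homotopy of multiplication by `c` along a complex
`⋅ → ⋅ → ⋅ → ⋅` with matrices `B`, `A`, `Z` (acting on rows): a homotopy `K`, `H` at the source
of `Z` extends to the source of `A`, since `B` followed by `A` is exact. -/
theorem Matrix.exists_homotopy_succ {S : Type*} [CommRing S] {q r s t : ℕ}
    {Z : Matrix (Fin r) (Fin q) S} {A : Matrix (Fin s) (Fin r) S} {B : Matrix (Fin t) (Fin s) S}
    (c : S) (hAZ : A * Z = 0)
    (hBA : ∀ v, Matrix.vecMul v A = 0 → v ∈ LinearMap.range B.vecMulLinear)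
    (K : Matrix (Fin q) (Fin r) S) (H : Matrix (Fin r) (Fin s) S)
    (h : Z * K + H * A = c • 1) :
    ∃ H' : Matrix (Fin s) (Fin t) S, A * H + H' * B = c • 1 := by
  have h₁ : (c • 1 - A * H) * A = 0 := by
    rw [Matrix.sub_mul, Matrix.mul_assoc, eq_sub_iff_add_eq'.2 h, Matrix.mul_sub,
      ← Matrix.mul_assoc, hAZ]
    simp
  have h₂ : ∀ i, ∃ w, Matrix.vecMul w B = (c • (1 : Matrix _ _ S) - A * H : Matrix _ _ S) i :=
    fun i => hBA _ (congrFun h₁ i)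
  choose H' hH' using h₂
  refine ⟨Matrix.of H', ?_⟩
  have h₃ : Matrix.of H' * B = c • 1 - A * H := Matrix.ext_row fun i => hH' i
  rw [h₃]
  abel

/-- A homotopy up to a unit makes a complex exact. -/
theorem Matrix.mem_range_of_homotopy {k : Type*} [Field k] {r s t : ℕ}
    {A : Matrix (Fin s) (Fin r) k} {B : Matrix (Fin t) (Fin s) k}
    {H : Matrix (Fin r) (Fin s) k} {H' : Matrix (Fin s) (Fin t) k} {c : k} (hc : c ≠ 0)
    (h : A * H + H' * B = c • 1) {v : Fin s → k} (hv : Matrix.vecMul v A = 0) :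
    v ∈ Set.range B.vecMulLinear := by
  have h₁ := congrArg (Matrix.vecMul v) h
  rw [Matrix.vecMul_add, ← Matrix.vecMul_vecMul, hv, Matrix.zero_vecMul, zero_add,
    ← Matrix.vecMul_vecMul, Matrix.vecMul_smul, Matrix.vecMul_one] at h₁
  refine ⟨c⁻¹ • Matrix.vecMul v H', ?_⟩
  rw [map_smul]
  change c⁻¹ • Matrix.vecMul (Matrix.vecMul v H') B = v
  rw [h₁, smul_smul, inv_mul_cancel₀ hc, one_smul]

/-- Let `A 0, A 1, …` be the matrices of a complex of free `S`-modules, exact except perhaps at the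
last place, and let `φ : S → k` be a homomorphism with a section `ι` to a field. If the
specialization of `A 0` is surjective, then the specialized complex is exact. -/
theorem Matrix.exact_map_of_surjective {S k : Type*} [CommRing S] [Field k] (φ : S →+* k)
    (ι : k →+* S) (hι : ∀ a, φ (ι a) = a) {r : ℕ → ℕ}
    (A : ∀ i, Matrix (Fin (r (i + 1))) (Fin (r i)) S) (hA : ∀ i, A (i + 1) * A i = 0)
    (hex : ∀ i v, Matrix.vecMul v (A i) = 0 → v ∈ LinearMap.range (A (i + 1)).vecMulLinear)
    (h₀ : Function.Surjective ((A 0).map φ).vecMulLinear) (i : ℕ) :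
    Function.Exact ((A (i + 1)).map φ).vecMulLinear ((A i).map φ).vecMulLinear := by
  choose b hb using fun j => h₀ (Pi.single j 1)
  have hb' : Matrix.of b * (A 0).map φ = 1 := Matrix.ext_row fun j => by
    ext l
    exact (congrFun (hb j) l).trans (by simp [Matrix.one_apply, Pi.single_apply, eq_comm])
  -- A lift of a right inverse of the specialization is one up to a determinant which is a unit
  -- at the given point.
  set T : Matrix (Fin (r 0)) (Fin (r 0)) S := (Matrix.of b).map ι * A 0 with hT
  have hφT : T.map φ = 1 := by
    rw [hT, Matrix.map_mul, Matrix.map_map]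
    have : (φ ∘ ι : k → k) = id := funext hι
    rw [this, Matrix.map_id, hb']
  have hdet : φ T.det = 1 := by
    rw [RingHom.map_det, RingHom.mapMatrix_apply, hφT, Matrix.det_one]
  have key : ∀ i, ∃ (H : Matrix (Fin (r i)) (Fin (r (i + 1))) S)
      (H' : Matrix (Fin (r (i + 1))) (Fin (r (i + 1 + 1))) S),
      A i * H + H' * A (i + 1) = T.det • 1 := by
    intro i
    induction i with
    | zero =>
      -- The complex is continued by the zero module on the right.
      have h : (0 : Matrix (Fin (r 0)) (Fin 0) S) * (0 : Matrix (Fin 0) (Fin (r 0)) S) +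
          (T.adjugate * (Matrix.of b).map ι) * A 0 = T.det • 1 := by
        rw [Matrix.mul_zero, zero_add, Matrix.mul_assoc, ← hT, Matrix.adjugate_mul]
      obtain ⟨H', hH'⟩ := Matrix.exists_homotopy_succ T.det (by simp) (hex 0) _ _ h
      exact ⟨_, H', hH'⟩
    | succ i ih =>
      obtain ⟨K, H, h⟩ := ih
      obtain ⟨H', hH'⟩ := Matrix.exists_homotopy_succ T.det (hA i) (hex (i + 1)) K H h
      exact ⟨H, H', hH'⟩
  intro v
  constructor
  · intro hv
    obtain ⟨H, H', h⟩ := key i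
    have h₁ := congrArg (fun N => N.map φ) h
    have h₂ : (A i).map φ * H.map φ + H'.map φ * (A (i + 1)).map φ = (1 : k) • 1 := by
      rw [← hdet, ← Matrix.map_mul, ← Matrix.map_mul, ← Matrix.map_add φ (map_add φ), h]
      ext a b
      simp [Matrix.one_apply, apply_ite φ]
    exact Matrix.mem_range_of_homotopy one_ne_zero h₂ hv
  · rintro ⟨w, rfl⟩
    change Matrix.vecMul (Matrix.vecMul w ((A (i + 1)).map φ)) ((A i).map φ) = 0
    rw [Matrix.vecMul_vecMul, ← Matrix.map_mul, hA i, Matrix.map_zero φ (map_zero φ),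
      Matrix.vecMul_zero]

/-! ### Points outside the characteristic variety -/

namespace DiffOp

variable {n : ℕ} {x : Fin n → ℝ}

/-- The principal symbol of degree `m` of a row, evaluated at `(x, ζ)` and composed with a linear
form `l`. Here `ℂ` is an `O`-module through the value at `x`. -/
def symbolForm {r : ℕ} (ρ : Fin r → ℤ) (ζ : Fin n → ℂ) (l : (Fin r → ℂ) →ₗ[ℂ] ℂ) (m : ℤ) :
    (Fin r → DiffOp x) →ₗ[AnalyticGerm x] ℂ :=
  l.restrictScalars (AnalyticGerm x) ∘ₗ
    (LinearMap.pi fun j => (aeval (R := AnalyticGerm x) ζ).toLinearMap ∘ₗ LinearMap.proj j) ∘ₗ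
      rowSymbol x ρ m

theorem symbolForm_apply {r : ℕ} (ρ : Fin r → ℤ) (ζ : Fin n → ℂ) (l : (Fin r → ℂ) →ₗ[ℂ] ℂ)
    (m : ℤ) (a : Fin r → DiffOp x) :
    symbolForm ρ ζ l m a = l fun j => aeval ζ (rowSymbol x ρ m a j) := rfl

theorem symbolForm_del_smul {r : ℕ} {ρ : Fin r → ℤ} (ζ : Fin n → ℂ) (l : (Fin r → ℂ) →ₗ[ℂ] ℂ)
    {m : ℤ} {a : Fin r → DiffOp x} (ha : a ∈ (shiftFiltration x ρ).piece m) (i : Fin n) :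
    symbolForm ρ ζ l (m + 1) (del (x := x) i • a) = ζ i * symbolForm ρ ζ l m a := by
  rw [symbolForm_apply, symbolForm_apply, ← smul_eq_mul, ← map_smul]
  congr 1
  funext j
  rw [rowSymbol_apply, Pi.smul_apply, Pi.smul_apply, smul_eq_mul, smul_eq_mul, rowSymbol_apply,
    show m + 1 - ρ j = m - ρ j + 1 by ring,
    symbolPart_del_mul i (mem_shiftFiltration.1 ha j), map_mul, aeval_X]

theorem symbolForm_single {r : ℕ} (ρ : Fin r → ℤ) (ζ : Fin n → ℂ) (l : (Fin r → ℂ) →ₗ[ℂ] ℂ)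
    (j : Fin r) : symbolForm (x := x) ρ ζ l (ρ j) (Pi.single j 1) = l (Pi.single j 1) := by
  rw [symbolForm_apply]
  congr 1
  funext i
  rw [rowSymbol_apply]
  by_cases hij : i = j
  · subst hij
    have h : symbolPart 0 (1 : DiffOp x) = 1 := by
      have h₁ : ofSymbol (monomial 0 (1 : AnalyticGerm x)) = 1 := by
        rw [ofSymbol_monomial, one_smul]
        exact map_one polyDel
      rw [← h₁, symbolPart_ofSymbol, homogPart_monomial, if_pos (by simp)]
      rfl
    rw [sub_self, Pi.single_eq_same, Pi.single_eq_same, h, map_one]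
  · rw [Pi.single_eq_of_ne hij, Pi.single_eq_of_ne hij, symbolPart_zero, map_zero]

end DiffOp

namespace DFiltration

variable {n : ℕ} {x : Fin n → ℝ} {M : Type*} [AddCommGroup M]
  [Module (AnalyticGerm x) M] [Module (DiffOp x) M]
  [IsScalarTower (AnalyticGerm x) (DiffOp x) M] {F : DFiltration x M}

/-- At a point `ζ` outside the characteristic variety, `gr M` has no nonzero specialization. -/
theorem eq_zero_of_notMem_charVariety {ζ : Fin n → ℂ} (hζ : ζ ∉ F.charVariety)
    (L : F.Gr →ₗ[AnalyticGerm x] ℂ) (hL : ∀ i v, L (F.xi i v) = ζ i * L v) : L = 0 := by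
  let L' : F.Fiber →ₗ[ℂ] ℂ := LinearMap.liftBaseChange ℂ L
  have htmul : ∀ (c : ℂ) (v : F.Gr), L' (c ⊗ₜ[AnalyticGerm x] v) = c * L v :=
    fun c v => LinearMap.liftBaseChange_tmul ..
  have hX : ∀ i v, L' (F.fiberXi i v) = ζ i * L' v := by
    intro i
    have h : ∀ v : ℂ ⊗[AnalyticGerm x] F.Gr, LinearMap.liftBaseChange ℂ L
        ((F.xi i).baseChange ℂ v) = ζ i * LinearMap.liftBaseChange ℂ L v := by
      intro v
      induction v using TensorProduct.induction_on with
      | zero => rw [map_zero, map_zero, mul_zero]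
      | tmul c v =>
        rw [LinearMap.baseChange_tmul, LinearMap.liftBaseChange_tmul,
          LinearMap.liftBaseChange_tmul, hL, smul_eq_mul, smul_eq_mul, mul_left_comm]
      | add v w hv hw => rw [map_add, map_add, map_add, mul_add, hv, hw]
    exact h
  have hp : ∀ (p : MvPolynomial (Fin n) ℂ) (v : F.Fiber), L' (p • v) = aeval ζ p * L' v := by
    intro p
    have e : ∀ (p : MvPolynomial (Fin n) ℂ) (v : F.Fiber),
        p • v = commEval (R := ℂ) F.fiberXi F.fiberXi_comm p v := fun _ _ => rfl
    induction p using MvPolynomial.induction_on with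
    | C a =>
      intro v
      rw [e, ← algebraMap_eq, AlgHom.commutes, AlgHom.commutes, Module.algebraMap_end_apply,
        map_smul]
      rfl
    | add p q hp hq =>
      intro v
      rw [add_smul, map_add, map_add, hp, hq, add_mul]
    | mul_X p i hp =>
      intro v
      rw [mul_smul, hp, e (X i), commEval_X, hX, map_mul, aeval_X, mul_assoc]
  refine LinearMap.ext fun v => ?_
  obtain ⟨s, hs, hsv⟩ := Module.notMem_support_iff'.1 hζ ((1 : ℂ) ⊗ₜ[AnalyticGerm x] v)
  have h := hp s ((1 : ℂ) ⊗ₜ[AnalyticGerm x] v)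
  rw [hsv, map_zero] at h
  have hs' : aeval ζ s ≠ 0 := fun h₀ => hs ((mem_vanishingIdeal_singleton_iff ζ s).2 h₀)
  have h₁ := (mul_eq_zero.1 h.symm).resolve_left hs'
  rwa [htmul, one_mul] at h₁

variable {r : ℕ} {ρ : Fin r → ℤ} {π : (Fin r → DiffOp x) →ₗ[DiffOp x] M}

theorem map_mem_of_isStrict (hπ : IsStrict (shiftFiltration x ρ) F π) {k : ℤ}
    {a : Fin r → DiffOp x} (ha : a ∈ (shiftFiltration x ρ).piece k) : π a ∈ F.piece k := by
  have h : π a ∈ π '' ((shiftFiltration x ρ).piece k : Set _) := ⟨a, ha, rfl⟩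
  rw [hπ k] at h
  exact h.2

/-- The map `D^ρ_k → M_k / M_{k-1}` induced by a filtered morphism `D^ρ → M`. -/
def toGrPiece (hπ : IsStrict (shiftFiltration x ρ) F π) (k : ℤ) :
    (shiftFiltration x ρ).piece k →ₗ[AnalyticGerm x] F.GrPiece k :=
  Submodule.mkQ _ ∘ₗ
    (π.restrictScalars (AnalyticGerm x)).restrict fun _ ha => map_mem_of_isStrict hπ ha

theorem toGrPiece_surjective (hπ : IsStrict (shiftFiltration x ρ) F π)
    (hs : Function.Surjective π) (k : ℤ) : Function.Surjective (toGrPiece hπ k) := by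
  intro v
  obtain ⟨⟨m, hm⟩, rfl⟩ := Submodule.Quotient.mk_surjective _ v
  obtain ⟨a, ha, rfl⟩ : m ∈ π '' ((shiftFiltration x ρ).piece k : Set _) := by
    rw [hπ k]
    exact ⟨hs m, hm⟩
  exact ⟨⟨a, ha⟩, rfl⟩

theorem toGrPiece_eq_zero_iff (hπ : IsStrict (shiftFiltration x ρ) F π) {k : ℤ}
    {a : Fin r → DiffOp x} (ha : a ∈ (shiftFiltration x ρ).piece k) :
    toGrPiece hπ k ⟨a, ha⟩ = 0 ↔ π a ∈ F.piece (k - 1) :=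
  Submodule.Quotient.mk_eq_zero ((F.piece (k - 1)).submoduleOf (F.piece k))

theorem xiPiece_toGrPiece (hπ : IsStrict (shiftFiltration x ρ) F π) (i : Fin n) {k : ℤ}
    {a : Fin r → DiffOp x} (ha : a ∈ (shiftFiltration x ρ).piece k)
    (ha' : del (x := x) i • a ∈ (shiftFiltration x ρ).piece (k + 1)) :
    F.xiPiece i k (toGrPiece hπ k ⟨a, ha⟩) = toGrPiece hπ (k + 1) ⟨del (x := x) i • a, ha'⟩ :=
  congrArg Submodule.Quotient.mk (Subtype.ext (map_smul π (del i) a).symm)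

variable {s : ℕ} {σ : Fin s → ℤ} {A : Matrix (Fin s) (Fin r) (DiffOp x)}

theorem symbolForm_eq_zero_of_map_mem_pred (hπ : IsStrict (shiftFiltration x ρ) F π)
    (hA : IsStrict (shiftFiltration x σ) (shiftFiltration x ρ) A.vecMulLinear)
    (hex : Function.Exact A.vecMulLinear π) {ζ : Fin n → ℂ} {l : (Fin r → ℂ) →ₗ[ℂ] ℂ}
    (hl : ∀ w, l (Matrix.vecMul w ((symbolMatrix σ ρ A).map (aeval ζ))) = 0) {k : ℤ}
    {a : Fin r → DiffOp x} (ha : a ∈ (shiftFiltration x ρ).piece k)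
    (h : π a ∈ F.piece (k - 1)) : symbolForm ρ ζ l k a = 0 := by
  obtain ⟨b, hb, hab⟩ : π a ∈ π '' ((shiftFiltration x ρ).piece (k - 1) : Set _) := by
    rw [hπ (k - 1)]
    exact ⟨⟨a, rfl⟩, h⟩
  obtain ⟨c, hc, hcab⟩ : a - b ∈ A.vecMulLinear '' ((shiftFiltration x σ).piece k : Set _) := by
    rw [hA k]
    exact ⟨(hex _).1 (by rw [map_sub, hab, sub_self]),
      sub_mem ha ((shiftFiltration x ρ).mono (sub_le_self k zero_le_one) hb)⟩
  have h₂ := rowSymbol_vecMul hA hc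
  have h₃ : Matrix.vecMul c A = a - b := hcab
  rw [h₃, map_sub, rowSymbol_eq_zero_of_mem_pred hb, sub_zero] at h₂
  rw [symbolForm_apply, h₂, ← hl fun i => aeval ζ (rowSymbol x σ k c i)]
  congr 1
  funext j
  exact RingHom.map_vecMul (aeval (R := AnalyticGerm x) ζ).toRingHom _ _ j

/-- At a point `ζ` outside the characteristic variety of `M`, the symbol of the matrix of a strict
presentation of `M` is surjective: a linear form vanishing on its image would induce a nonzero
specialization of `gr M` at `ζ`. -/
theorem symbolMatrix_surjective (hπ : IsStrict (shiftFiltration x ρ) F π)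
    (hs : Function.Surjective π)
    (hA : IsStrict (shiftFiltration x σ) (shiftFiltration x ρ) A.vecMulLinear)
    (hex : Function.Exact A.vecMulLinear π) {ζ : Fin n → ℂ} (hζ : ζ ∉ F.charVariety) :
    Function.Surjective ((symbolMatrix σ ρ A).map (aeval ζ)).vecMulLinear := by
  rw [← LinearMap.range_eq_top]
  by_contra htop
  obtain ⟨l, hl₀, hl⟩ := Submodule.exists_le_ker_of_lt_top _ (lt_top_iff_ne_top.2 htop)
  replace hl : ∀ w, l (Matrix.vecMul w ((symbolMatrix σ ρ A).map (aeval ζ))) = 0 :=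
    fun w => hl ⟨w, rfl⟩
  have hΛ : ∀ k, ∃ Λ : F.GrPiece k →ₗ[AnalyticGerm x] ℂ,
      ∀ a ha, Λ (toGrPiece hπ k ⟨a, ha⟩) = symbolForm ρ ζ l k a := by
    intro k
    let f := symbolForm ρ ζ l k ∘ₗ ((shiftFiltration x ρ).piece k).subtype
    have hf : LinearMap.ker (toGrPiece hπ k) ≤ LinearMap.ker f := by
      rintro ⟨a, ha⟩ h
      exact symbolForm_eq_zero_of_map_mem_pred hπ hA hex hl ha
        ((toGrPiece_eq_zero_iff hπ ha).1 h)
    let e := (toGrPiece hπ k).quotKerEquivOfSurjective (toGrPiece_surjective hπ hs k)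
    refine ⟨(LinearMap.ker (toGrPiece hπ k)).liftQ f hf ∘ₗ e.symm.toLinearMap, fun a ha => ?_⟩
    have h : e.symm (toGrPiece hπ k ⟨a, ha⟩) = Submodule.Quotient.mk ⟨a, ha⟩ :=
      e.symm_apply_eq.2 rfl
    rw [LinearMap.comp_apply, LinearEquiv.coe_coe, h]
    rfl
  choose Λ hΛ using hΛ
  have hL := eq_zero_of_notMem_charVariety hζ (DirectSum.toModule (AnalyticGerm x) ℤ ℂ Λ) (by
    intro i v
    induction v using DirectSum.induction_on with
    | zero => rw [map_zero, map_zero, mul_zero]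
    | of k v =>
      obtain ⟨⟨a, ha⟩, rfl⟩ := toGrPiece_surjective hπ hs k v
      have ha' : del (x := x) i • a ∈ (shiftFiltration x ρ).piece (k + 1) := by
        rw [add_comm]
        exact (shiftFiltration x ρ).smul_mem 1 k _ _ (del_mem_orderLE i) ha
      rw [← DirectSum.lof_eq_of (AnalyticGerm x), xi_lof, DirectSum.toModule_lof,
        DirectSum.toModule_lof, xiPiece_toGrPiece hπ i ha ha', hΛ, hΛ, symbolForm_del_smul ζ l ha]
    | add v w hv hw => rw [map_add, map_add, map_add, mul_add, hv, hw])
  refine hl₀ (LinearMap.pi_ext' fun j => LinearMap.ext_ring ?_)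
  have hj : (Pi.single j 1 : Fin r → DiffOp x) ∈ (shiftFiltration x ρ).piece (ρ j) :=
    single_mem_shiftFiltration ρ j
  have h := LinearMap.congr_fun hL
    (DirectSum.lof (AnalyticGerm x) ℤ (fun k => F.GrPiece k) _ (toGrPiece hπ (ρ j) ⟨_, hj⟩))
  rw [DirectSum.toModule_lof, hΛ, symbolForm_single] at h
  exact h

end DFiltration

/-! ### Ellipticity of strict resolutions -/

theorem StrictFreeResolution.isElliptic_of_isElliptic {n : ℕ} {x : Fin n → ℝ} {M : Type*}
    [AddCommGroup M] [Module (AnalyticGerm x) M] [Module (DiffOp x) M]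
    [IsScalarTower (AnalyticGerm x) (DiffOp x) M] {F : DFiltration x M}
    (hell : F.IsElliptic) (R : StrictFreeResolution F) : R.IsElliptic := by
  intro ξ hξ
  have h₀ : Function.Surjective (R.symbol 0 fun i => (ξ i : ℂ)).vecMulLinear :=
    DFiltration.symbolMatrix_surjective R.strict_aug R.aug_surjective (R.strict_matrix 0)
      R.exact_aug (hell ξ hξ)
  refine ⟨h₀, fun k => ?_⟩
  exact Matrix.exact_map_of_surjective (aeval (R := AnalyticGerm x) fun i => (ξ i : ℂ)).toRingHom
    (C.comp (algebraMap ℂ (AnalyticGerm x)))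
    (fun a => (aeval_C (R := AnalyticGerm x) (fun i => (ξ i : ℂ)) (algebraMap ℂ _ a)).trans rfl)
    (fun k => symbolMatrix (R.shift (k + 1)) (R.shift k) (R.matrix k))
    (fun k => symbolMatrix_mul_eq_zero (R.strict_matrix k) (R.strict_matrix (k + 1))
      (R.exact_matrix k))
    (fun k _ hv => mem_range_symbolMatrix (R.strict_matrix k) (R.strict_matrix (k + 1))
      (R.exact_matrix k) hv) h₀ k

end

theorem mainTheorem8 {n : ℕ} (x : Fin n → ℝ) {M : Type*} [AddCommGroup M]
    [Module (AnalyticGerm x) M] [Module (DiffOp x) M]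
    [IsScalarTower (AnalyticGerm x) (DiffOp x) M] (F : DFiltration x M)
    (hfree : Module.Free (AnalyticGerm x) F.Gr) (hell : F.IsElliptic)
    (R : StrictFreeResolution F) : R.IsElliptic :=
  R.isElliptic_of_isElliptic hell
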